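/- Let $N, L \in \mathbb{N}_+$ and $\Gamma = [-1,1]^N$. Put $m(0)=0$, $m(1) = 1$ and $m(l) = 2^{l-1}+1$ for $l > 1$. Let $\vartheta^0=\emptyset$, $\vartheta^1 = \{0\}$ and, for $l>1$, let $\vartheta^l = \{ -\cos\left(\frac{\pi (j-1)}{m(l)-1}\right) : j = 1,\dots,m(l)\}$ be the Clenshaw-Curtis abscissas. For $x\in\vartheta^l$ let $\psi^l_x(y) = \prod_{z \in \vartheta^l\setminus\{x\}} \frac{y-z}{x-z}$ be the Lagrange polynomial, and let $\mathscr{U}^{m(l)}[v](y) = \sum_{x\in\vartheta^l} v(x)\psi^l_x(y)$, so that $\mathscr{U}^{m(0)}=0$. For $\mathbf{l}\in\mathbb{N}_+^N$ let $g(\mathbf{l}) = \sum_{n=1}^N (l_n-1)$. The isotropic Clenshaw-Curtis Smolyak sparse-grid interpolation operator of level $L$ is $$\mathcal{I}_L[v] = \sum_{g(\mathbf{l})\le L}\ \bigotimes_{n=1}^N\left(\mathscr{U}^{m(l_n)}-\mathscr{U}^{m(l_n-1)}\right)[v] = \sum_{g(\mathbf{l})\le L}\ \sum_{\mathbf{i}\in\{0,1\}^N}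 (-1)^{|\mathbf{i}|}\left(\mathscr{U}^{m(l_1-i_1)}\otimes\cdots\otimes\mathscr{U}^{m(l_N-i_N)}\right)[v].$$ With the sparse grid $\mathcal{H}_L = \bigcup_{g(\mathbf{l})=L} \vartheta^{l_1}\times\cdots\times\vartheta^{l_N}$ it has the form $\mathcal{I}_L[v](y) = \sum_{x\in\mathcal{H}_L} v(x)\,\Psi_{L,x}(y)$, where $$\Psi_{L,x}(y) = \sum_{g(\mathbf{l})\le L}\ \sum_{\substack{\mathbf{i}\in\{0,1\}^N\\ x\in \vartheta^{l_1-i_1}\times\cdots\times\vartheta^{l_N-i_N}}} (-1)^{|\mathbf{i}|}\prod_{n=1}^N \psi^{l_n-i_n}_{x_n}(y_n).$$ Then the Lebesgue constant $\mathbb{L}_L = \max_{y\in\Gamma}\sum_{x\in\mathcal{H}_L} |\Psi_{L,x}(y)|$ satisfies $$\mathbb{L}_L \le \left[(L+1)(L+2)\right]^N.$$ -/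

import Mathlib

namespace SparseGrid

open Finset

noncomputable section

/-- Number of one-dimensional nodes on level `l`: `m(1) = 1` and `m(l) = 2^(l-1) + 1` for `l > 1`.
The value `m(0) = 0` goes with the convention that the interpolation operator of level `0` is
zero. -/
def m : ℕ → ℕ
  | 0 => 0
  | 1 => 1
  | l + 2 => 2 ^ (l + 1) + 1

/-- The one-dimensional Clenshaw-Curtis abscissas of level `l` in `[-1,1]`: the single point `0` on
level `1`, and the points `-cos (π j / (m(l) - 1))`, `j = 0, …, m(l) - 1`, on every level `l > 1`.
(Level `0` has no points.) -/
def nodes : ℕ → Finset ℝ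
  | 0 => ∅
  | 1 => {0}
  | l + 2 => (range (m (l + 2))).image
      fun j : ℕ => -Real.cos (Real.pi * (j : ℝ) / ((m (l + 2) : ℝ) - 1))

/-- The one-dimensional Lagrange polynomial of level `l` that belongs to the node `x`, i.e.
`∏ (y - z) / (x - z)` over the nodes `z ≠ x` of level `l`, evaluated at `y`. -/
def psi (l : ℕ) (x y : ℝ) : ℝ := (Lagrange.basis (nodes l) id x).eval y

/-- The tensor grid `ϑ^{l_1} × ⋯ × ϑ^{l_N}`. -/
def tensorGrid {N : ℕ} (l : Fin N → ℕ) : Finset (Fin N → ℝ) :=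
  Fintype.piFinset fun n => nodes (l n)

/-- The tensor product `U^{m(l_1)} ⊗ ⋯ ⊗ U^{m(l_N)}` of one-dimensional Lagrange interpolation
operators, applied to `v` and evaluated at `y`. It is zero if some `l_n = 0`. -/
def tensorInterp {N : ℕ} (l : Fin N → ℕ) (v : (Fin N → ℝ) → ℝ) (y : Fin N → ℝ) : ℝ :=
  ∑ x ∈ tensorGrid l, v x * ∏ n, psi (l n) (x n) (y n)

/-- The isotropic Smolyak function `g(l) = ∑ (l_n - 1)`, used for `l_n ≥ 1` only. -/
def g {N : ℕ} (l : Fin N → ℕ) : ℕ := ∑ n, (l n - 1)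

/-- The multi-indices `l` with all `l_n ≥ 1` and `g(l) ≤ L` (which forces `l_n ≤ L + 1`). -/
def multiIndices (N L : ℕ) : Finset (Fin N → ℕ) :=
  (Fintype.piFinset fun _ => Icc 1 (L + 1)).filter fun l => g l ≤ L

/-- The set `{0,1}^N`. -/
def binaryIndices (N : ℕ) : Finset (Fin N → ℕ) := Fintype.piFinset fun _ => {0, 1}

/-- The isotropic Clenshaw-Curtis Smolyak operator of level `L`:
`∑_{g(l) ≤ L} ⨂_n (U^{m(l_n)} - U^{m(l_n - 1)})`, expanded over `{0,1}^N`. -/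
def smolyak (N L : ℕ) (v : (Fin N → ℝ) → ℝ) (y : Fin N → ℝ) : ℝ :=
  ∑ l ∈ multiIndices N L, ∑ i ∈ binaryIndices N,
    (-1) ^ (∑ n, i n) * tensorInterp (fun n => l n - i n) v y

/-- The sparse grid of level `L`: the union of the tensor grids with `g(l) = L`. -/
def sparseGrid (N L : ℕ) : Finset (Fin N → ℝ) :=
  ((multiIndices N L).filter fun l => g l = L).biUnion tensorGrid

/-- The sparse-grid Lagrange function of level `L` that belongs to the collocation point `x`:
the signed sum of the tensorized Lagrange polynomials at `x` of all those tensor operators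
`U^{m(l_1 - i_1)} ⊗ ⋯ ⊗ U^{m(l_N - i_N)}` in the Smolyak operator that use the point `x`. -/
def Psi (N L : ℕ) (x y : Fin N → ℝ) : ℝ :=
  ∑ l ∈ multiIndices N L,
    ∑ i ∈ (binaryIndices N).filter fun i => x ∈ tensorGrid fun n => l n - i n,
      (-1) ^ (∑ n, i n) * ∏ n, psi (l n - i n) (x n) (y n)

/-- The domain `Γ = [-1,1]^N`. -/
def Gam (N : ℕ) : Set (Fin N → ℝ) := Set.univ.pi fun _ => Set.Icc (-1) 1

/-- The Lebesgue function `y ↦ ∑_j |Ψ_j(y)|`, summed over the collocation points. -/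
def lebesgueFun (N L : ℕ) (y : Fin N → ℝ) : ℝ := ∑ x ∈ sparseGrid N L, |Psi N L x y|

/-- The Lebesgue constant: the maximum of the Lebesgue function over `Γ`. -/
def lebesgueConst (N L : ℕ) : ℝ := sSup (lebesgueFun N L '' Gam N)

/-- The supremum in the definition of the Lebesgue constant is a maximum. -/
theorem isGreatest_lebesgueConst (N L : ℕ) :
    IsGreatest (lebesgueFun N L '' Gam N) (lebesgueConst N L) := by
  have hc : IsCompact (Gam N) := isCompact_univ_pi fun _ => isCompact_Icc
  have hn : (Gam N).Nonempty := ⟨0, fun n _ => by simp⟩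
  have hf : Continuous (lebesgueFun N L) := by
    unfold lebesgueFun Psi psi
    fun_prop
  exact (hc.image hf).isGreatest_sSup (hn.image _)

/-- The Clenshaw-Curtis abscissas are nested. -/
theorem nodes_subset_succ (l : ℕ) : nodes l ⊆ nodes (l + 1) := by
  match l with
  | 0 => simp [nodes]
  | 1 =>
    intro x hx
    simp only [nodes, mem_singleton] at hx
    subst hx
    simp only [nodes, mem_image, mem_range]
    refine ⟨1, by simp [m], ?_⟩
    have h : Real.pi * ((1 : ℕ) : ℝ) / ((m 2 : ℝ) - 1) = Real.pi / 2 := by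
      norm_num [m]
    rw [show (0 + 2 : ℕ) = 2 from rfl, h, Real.cos_pi_div_two, neg_zero]
  | l + 2 =>
    intro x hx
    simp only [nodes, mem_image, mem_range] at hx ⊢
    obtain ⟨j, hj, rfl⟩ := hx
    refine ⟨2 * j, ?_, ?_⟩
    · simp only [m] at hj ⊢
      rw [pow_succ]
      omega
    · congr 2
      simp only [m]
      push_cast
      rw [pow_succ (2 : ℝ) (l + 1)]
      field_simp
      ring

theorem nodes_mono : Monotone nodes := monotone_nat_of_le_succ nodes_subset_succ

/-- All points used by the Smolyak operator lie in the sparse grid. -/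
theorem tensorGrid_subset_sparseGrid {N L : ℕ} (hN : 1 ≤ N) {l i : Fin N → ℕ}
    (hl : l ∈ multiIndices N L) : (tensorGrid fun n => l n - i n) ⊆ sparseGrid N L := by
  intro x hx
  have hl2 := hl
  simp only [multiIndices, mem_filter, Fintype.mem_piFinset, mem_Icc] at hl2
  obtain ⟨h1, hg⟩ := hl2
  let n0 : Fin N := ⟨0, hN⟩
  let k : Fin N → ℕ := Function.update l n0 (l n0 + (L - g l))
  have hkl : ∀ n, l n ≤ k n := by
    intro n
    by_cases h : n = n0
    · subst h; simp [k]
    · simp [k, h]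
  have hgk : g k = L := by
    have e1 : g k = (k n0 - 1) + ∑ n ∈ univ.erase n0, (k n - 1) :=
      (add_sum_erase _ _ (mem_univ n0)).symm
    have e2 : g l = (l n0 - 1) + ∑ n ∈ univ.erase n0, (l n - 1) :=
      (add_sum_erase _ _ (mem_univ n0)).symm
    have e3 : ∑ n ∈ univ.erase n0, (k n - 1) = ∑ n ∈ univ.erase n0, (l n - 1) := by
      refine sum_congr rfl fun n hn => ?_
      simp [k, (mem_erase.1 hn).1]
    have e4 : k n0 = l n0 + (L - g l) := by simp [k]
    have := (h1 n0).1
    omega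
  have hk1 : ∀ n, k n ≤ L + 1 := by
    intro n
    have : k n - 1 ≤ g k :=
      single_le_sum (f := fun n => k n - 1) (fun _ _ => Nat.zero_le _) (mem_univ n)
    omega
  simp only [sparseGrid, mem_biUnion, mem_filter, multiIndices, Fintype.mem_piFinset, mem_Icc]
  refine ⟨k, ⟨⟨fun n => ⟨(h1 n).1.trans (hkl n), hk1 n⟩, hgk.le⟩, hgk⟩, ?_⟩
  simp only [tensorGrid, Fintype.mem_piFinset] at hx ⊢
  exact fun n => nodes_mono ((Nat.sub_le _ _).trans (hkl n)) (hx n)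

/-- The Smolyak operator in terms of its Lagrange functions. -/
theorem smolyak_eq_sum_Psi {N : ℕ} (hN : 1 ≤ N) (L : ℕ) (v : (Fin N → ℝ) → ℝ) (y : Fin N → ℝ) :
    smolyak N L v y = ∑ x ∈ sparseGrid N L, v x * Psi N L x y := by
  simp only [smolyak, Psi, mul_sum, tensorInterp]
  conv_rhs => rw [sum_comm]
  refine sum_congr rfl fun l hl => ?_
  simp only [sum_filter]
  conv_rhs => rw [sum_comm]
  refine sum_congr rfl fun i _ => ?_
  rw [← sum_filter, filter_mem_eq_inter,
    inter_eq_right.2 (tensorGrid_subset_sparseGrid hN hl)]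
  exact sum_congr rfl fun x _ => by ring

end

end SparseGrid

namespace SparseGrid

open Finset Polynomial

/-! Expanding the differences, using the triangle inequality and dropping the constraint `g l ≤ L`
bounds the Lebesgue function by a product over directions of `∑ (λ_l + λ_{l-1})`, `1 ≤ l ≤ L + 1`,
where `λ_l` is the one-dimensional Lebesgue function (`lebesgueFun_le_prod`). It remains to bound
`λ_l` linearly in `l`.

For `n = 2 ^ (l - 1)` the nodes are the Chebyshev extrema `cos (j π / n)`. At `cos t` the moduli of
the Lagrange polynomials are dominated by a cotangent kernel at `2n` equispaced angles on the
circle. The two angles nearest `t` contribute at most `1` each, the others at most `1 / (π r)`, `1 ≤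
r < n`, on each side. Hence `λ_l ≤ 2 + (2 / π) H_{n-1}`, where `H_{n-1} ≤ l - 1` and `π > 3`.
Summing over `l` gives `(L + 1) (L + 2)`. -/

/-! ### Nodal polynomial of the Chebyshev extrema -/

/-- The polynomial `(X ^ 2 - 1) * U_p`, whose roots are the Chebyshev extrema of order `p + 1`. -/
noncomputable def extremaPoly (p : ℕ) : ℝ[X] := (X ^ 2 - 1) * Chebyshev.U ℝ p

theorem degree_extremaPoly (p : ℕ) : (extremaPoly p).degree = (p + 2 : ℕ) := by
  have h : (X ^ 2 - 1 : ℝ[X]).degree = 2 := by compute_degree!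
  rw [extremaPoly, degree_mul, h, Chebyshev.degree_U_natCast]
  push_cast
  ring

theorem leadingCoeff_extremaPoly_ne_zero (p : ℕ) : (extremaPoly p).leadingCoeff ≠ 0 := by
  refine leadingCoeff_ne_zero.2 fun h => ?_
  have := degree_extremaPoly p
  rw [h, degree_zero] at this
  exact WithBot.bot_ne_natCast _ this

theorem eval_cos_extremaPoly (p : ℕ) (t : ℝ) :
    (extremaPoly p).eval (Real.cos t) = -(Real.sin t * Real.sin ((p + 1 : ℕ) * t)) := by
  have h := Chebyshev.U_real_cos t p
  have h2 := Real.sin_sq_add_cos_sq t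
  simp only [extremaPoly, eval_mul, eval_sub, eval_pow, eval_X, eval_one]
  push_cast at h ⊢
  rw [← h]
  linear_combination ((Chebyshev.U ℝ p).eval (Real.cos t)) * h2

/-- This form makes the values at the nodes visible: inside, `U_p` vanishes and `|T_{p+1}| = 1`; at
`±1` the two terms have equal sign and modulus, which doubles the value. -/
theorem derivative_extremaPoly (p : ℕ) :
    derivative (extremaPoly p) =
      X * Chebyshev.U ℝ p + ((p : ℝ[X]) + 1) * Chebyshev.T ℝ (p + 1) := by
  have h := Chebyshev.add_one_mul_T_eq_poly_in_U (R := ℝ) p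
  rw [extremaPoly, derivative_mul]
  simp only [derivative_sub, derivative_X_pow, derivative_one]
  push_cast at h ⊢
  simp only [map_ofNat]
  linear_combination -h

theorem node_eq_cos (n j : ℕ) : Chebyshev.node n j = Real.cos (j * Real.pi / n) := rfl

theorem injOn_node (n : ℕ) : Set.InjOn (Chebyshev.node n) (range (n + 1)) :=
  (Chebyshev.strictAntiOn_node n).injOn

theorem eval_node_extremaPoly (p j : ℕ) :
    (extremaPoly p).eval (Chebyshev.node (p + 1) j) = 0 := by
  rw [node_eq_cos, eval_cos_extremaPoly]
  have : ((p + 1 : ℕ) : ℝ) * (j * Real.pi / (p + 1 : ℕ)) = j * Real.pi := by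
    field_simp
  rw [this, Real.sin_nat_mul_pi]
  ring

theorem abs_eval_node_T {n j : ℕ} (hj : j ≤ n) :
    |(Chebyshev.T ℝ n).eval (Chebyshev.node n j)| = 1 := by
  rw [Chebyshev.eval_T_real_node (by simpa using hj)]
  simp

theorem abs_eval_node_derivative_extremaPoly {p j : ℕ} (h0 : 0 < j) (hj : j ≤ p) :
    |(derivative (extremaPoly p)).eval (Chebyshev.node (p + 1) j)| = (p + 1 : ℕ) := by
  have hT := abs_eval_node_T (n := p + 1) (j := j) (by omega)
  have hW := eval_node_extremaPoly p j
  have h1 : Chebyshev.node (p + 1) j < 1 := by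
    rw [← Chebyshev.node_eq_one (n := p + 1)]
    exact Chebyshev.node_lt (by omega) h0
  have h2 : -1 < Chebyshev.node (p + 1) j := by
    rw [← Chebyshev.node_eq_neg_one (n := p + 1) (by omega)]
    exact Chebyshev.node_lt le_rfl (by omega)
  have hU : (Chebyshev.U ℝ p).eval (Chebyshev.node (p + 1) j) = 0 := by
    simp only [extremaPoly, eval_mul, eval_sub, eval_pow, eval_X, eval_one] at hW
    refine (mul_eq_zero.1 hW).resolve_left ?_
    nlinarith
  rw [derivative_extremaPoly]
  push_cast at hT ⊢
  simp only [eval_add, eval_mul, eval_X, hU, eval_natCast, eval_one, mul_zero, zero_add, abs_mul,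
    hT, mul_one]
  exact abs_of_nonneg (by positivity)

theorem abs_eval_one_derivative_extremaPoly (p : ℕ) :
    |(derivative (extremaPoly p)).eval 1| = 2 * (p + 1 : ℕ) := by
  rw [derivative_extremaPoly]
  simp only [eval_add, eval_mul, eval_X, eval_natCast, eval_one, Chebyshev.U_eval_one,
    Chebyshev.T_eval_one]
  push_cast
  rw [abs_of_nonneg (by positivity)]
  ring

theorem abs_eval_neg_one_derivative_extremaPoly (p : ℕ) :
    |(derivative (extremaPoly p)).eval (-1)| = 2 * (p + 1 : ℕ) := by
  rw [derivative_extremaPoly]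
  simp only [eval_add, eval_mul, eval_X, eval_natCast, eval_one, Chebyshev.U_eval_neg_one,
    Chebyshev.T_eval_neg_one, Int.negOnePow_succ]
  push_cast
  have h : |((p : ℤ).negOnePow : ℝ)| = 1 := by
    rcases Int.even_or_odd (p : ℤ) with h | h <;>
      simp [Int.negOnePow_even, Int.negOnePow_odd, h]
  rw [show -1 * (((p : ℤ).negOnePow : ℝ) * (p + 1)) + (p + 1) * -((p : ℤ).negOnePow : ℝ) =
    -(((p : ℤ).negOnePow : ℝ) * (2 * (p + 1))) by ring, abs_neg, abs_mul, h, one_mul]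
  exact abs_of_nonneg (by positivity)

/-- The Chebyshev extrema of order `n`. -/
noncomputable def extrema (n : ℕ) : Finset ℝ := (range (n + 1)).image (Chebyshev.node n)

theorem extremaPoly_eq (p : ℕ) :
    extremaPoly p =
      C (extremaPoly p).leadingCoeff * Lagrange.nodal (extrema (p + 1)) id := by
  have hcard : #(extrema (p + 1)) = p + 2 := by
    rw [extrema, card_image_of_injOn (injOn_node _), card_range]
  have hdeg : (C (extremaPoly p).leadingCoeff * Lagrange.nodal (extrema (p + 1)) id).degree =
      (p + 2 : ℕ) := by
    rw [degree_mul, degree_C (leadingCoeff_extremaPoly_ne_zero p), Lagrange.degree_nodal, hcard, zero_add]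
  refine eq_of_degree_le_of_eval_index_eq (v := id) (extrema (p + 1)) (Set.injOn_id _) ?_ ?_ ?_ ?_
  · rw [degree_extremaPoly, hcard]
  · rw [degree_extremaPoly, hdeg]
  · rw [leadingCoeff_mul, leadingCoeff_C, Lagrange.nodal_monic.leadingCoeff, mul_one]
  · intro x hx
    rw [eval_mul, Lagrange.eval_nodal_at_node hx, mul_zero]
    obtain ⟨j, -, rfl⟩ := mem_image.1 hx
    exact eval_node_extremaPoly p j

theorem eval_basis_extrema {p : ℕ} {x y : ℝ} (hx : x ∈ extrema (p + 1)) (hxy : y ≠ x) :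
    (Lagrange.basis (extrema (p + 1)) id x).eval y =
      (extremaPoly p).eval y / ((derivative (extremaPoly p)).eval x * (y - x)) := by
  have hW := extremaPoly_eq p
  have hne := leadingCoeff_extremaPoly_ne_zero p
  generalize (extremaPoly p).leadingCoeff = c at hW hne
  rw [Lagrange.eval_basis_not_at_node hx hxy, Lagrange.nodalWeight_eq_eval_derivative_nodal hx,
    hW, derivative_C_mul, eval_C_mul, eval_C_mul, id, mul_assoc,
    mul_div_mul_left _ _ hne, div_eq_mul_inv, mul_inv]

/-! ### Cotangent kernel -/

/-- The modulus of the trigonometric interpolation kernel `sin (n s) cot (s / 2) / (2 n)` at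
`s = t - j π / n`. -/
noncomputable def cotKernel (n : ℕ) (t : ℝ) (j : ℤ) : ℝ :=
  |Real.sin (n * t)| * |Real.cot ((t - j * Real.pi / n) / 2)| / (2 * n)

theorem cotKernel_periodic {n : ℕ} (hn : n ≠ 0) (t : ℝ) (j : ℤ) :
    cotKernel n t (j + 2 * n) = cotKernel n t j := by
  have : (t - (j + 2 * n : ℤ) * Real.pi / n) / 2 = (t - j * Real.pi / n) / 2 - Real.pi := by
    push_cast
    field_simp
    ring
  rw [cotKernel, this, Real.cot_eq_cos_div_sin, Real.cos_sub_pi, Real.sin_sub_pi, neg_div_neg_eq,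
    ← Real.cot_eq_cos_div_sin, cotKernel]

/-- Half-angle formulas turn the quotient without moduli into exactly minus the mean of the two
cotangents. -/
theorem abs_sin_div_cos_sub_cos_le {t s : ℝ} (h : Real.cos t ≠ Real.cos s) :
    |Real.sin t| / |Real.cos t - Real.cos s| ≤
      (|Real.cot ((t - s) / 2)| + |Real.cot ((t + s) / 2)|) / 2 := by
  have hc := Real.cos_sub_cos t s
  have ha : Real.sin ((t + s) / 2) ≠ 0 := by
    intro h0
    rw [h0] at hc
    exact h (by linarith)
  have hb : Real.sin ((t - s) / 2) ≠ 0 := by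
    intro h0
    rw [h0] at hc
    exact h (by linarith)
  have hs : Real.sin t = Real.sin ((t + s) / 2) * Real.cos ((t - s) / 2) +
      Real.cos ((t + s) / 2) * Real.sin ((t - s) / 2) := by
    rw [← Real.sin_add]
    congr 1
    ring
  have : Real.sin t / (Real.cos t - Real.cos s) =
      -(Real.cot ((t - s) / 2) + Real.cot ((t + s) / 2)) / 2 := by
    rw [hc, hs, Real.cot_eq_cos_div_sin, Real.cot_eq_cos_div_sin]
    field_simp
  rw [← abs_div, this, abs_div, abs_neg, abs_two]
  gcongr
  exact abs_add_le _ _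

theorem abs_eval_basis_extrema_le {p j : ℕ} (hj : j ≤ p + 1) {t : ℝ}
    (ht : Real.cos t ∉ extrema (p + 1)) {d : ℝ} (hd : 0 < d)
    (hW : |(derivative (extremaPoly p)).eval (Chebyshev.node (p + 1) j)| = d) :
    |(Lagrange.basis (extrema (p + 1)) id (Chebyshev.node (p + 1) j)).eval (Real.cos t)| ≤
      (p + 1 : ℕ) / d * (cotKernel (p + 1) t j + cotKernel (p + 1) t (-j)) := by
  have hx : Chebyshev.node (p + 1) j ∈ extrema (p + 1) :=
    mem_image_of_mem _ (mem_range.2 (by omega))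
  have hne : Real.cos t ≠ Chebyshev.node (p + 1) j := fun h => ht (h ▸ hx)
  have key := abs_sin_div_cos_sub_cos_le (t := t) (s := j * Real.pi / (p + 1 : ℕ)) hne
  rw [eval_basis_extrema hx hne, eval_cos_extremaPoly, abs_div, abs_mul, hW, abs_neg, abs_mul]
  calc |Real.sin t| * |Real.sin ((p + 1 : ℕ) * t)| / (d * |Real.cos t - Chebyshev.node (p + 1) j|)
      = |Real.sin ((p + 1 : ℕ) * t)| / d *
        (|Real.sin t| / |Real.cos t - Real.cos (j * Real.pi / (p + 1 : ℕ))|) := by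
        rw [div_mul_div_comm, mul_comm |Real.sin t|]
        rfl
    _ ≤ |Real.sin ((p + 1 : ℕ) * t)| / d *
        ((|Real.cot ((t - j * Real.pi / (p + 1 : ℕ)) / 2)| +
          |Real.cot ((t + j * Real.pi / (p + 1 : ℕ)) / 2)|) / 2) := by
        gcongr
    _ = _ := by
        simp only [cotKernel]
        push_cast
        rw [show t - -(j : ℝ) * Real.pi / (p + 1) = t + j * Real.pi / (p + 1) by ring]
        field_simp

/-! ### Sums over one period -/

/-- The sum of the values of a function over a window of `2 * n` integers around `c`. -/
def windowSum (f : ℤ → ℝ) (n : ℕ) (c : ℤ) : ℝ :=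
  ∑ r ∈ range n, f (c - r) + ∑ r ∈ range n, f (c + 1 + r)

/-- The shift drops the index `c + 1 - n` and gains `c + 1 + n`, which differ by one period. -/
theorem windowSum_add_one {f : ℤ → ℝ} {n : ℕ} (hf : ∀ j, f (j + 2 * n) = f j) (c : ℤ) :
    windowSum f n (c + 1) = windowSum f n c := by
  have h1 : ∑ r ∈ range n, f (c + 1 - r) + f (c + 1 - n) =
      ∑ r ∈ range n, f (c - r) + f (c + 1) := by
    rw [← sum_range_succ (fun r : ℕ => f (c + 1 - r)), sum_range_succ']
    congr 1
    · refine sum_congr rfl fun r _ => ?_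
      congr 1
      push_cast
      ring
    · simp
  have h2 : ∑ r ∈ range n, f (c + 1 + r) + f (c + 1 + n) =
      ∑ r ∈ range n, f (c + 1 + 1 + r) + f (c + 1) := by
    rw [← sum_range_succ (fun r : ℕ => f (c + 1 + r)), sum_range_succ']
    congr 1
    · refine sum_congr rfl fun r _ => ?_
      congr 1
      push_cast
      ring
    · simp
  have h3 : f (c + 1 + n) = f (c + 1 - n) := by
    rw [← hf (c + 1 - n)]
    congr 1
    ring
  simp only [windowSum]
  linarith

theorem windowSum_natCast {f : ℤ → ℝ} {n : ℕ} (hf : ∀ j, f (j + 2 * n) = f j) (q : ℕ) :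
    windowSum f n q = windowSum f n 0 := by
  induction q with
  | zero => rfl
  | succ q ih => rw [Nat.cast_succ, windowSum_add_one hf, ih]

/-- An interior node accounts for the two indices `±j`. At the end nodes these coincide modulo `2n`,
and the doubled derivative there halves the bound, so each index of a period is counted once. -/
theorem sum_abs_eval_basis_extrema_le_windowSum (p : ℕ) {t : ℝ}
    (ht : Real.cos t ∉ extrema (p + 1)) :
    ∑ x ∈ extrema (p + 1), |(Lagrange.basis (extrema (p + 1)) id x).eval (Real.cos t)| ≤
      windowSum (cotKernel (p + 1) t) (p + 1) 0 := by
  have hp : (0 : ℝ) < (p + 1 : ℕ) := by positivity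
  have h0 := abs_eval_basis_extrema_le (j := 0) (by omega) ht (d := 2 * (p + 1 : ℕ)) (by positivity)
    (by rw [Chebyshev.node_eq_one, abs_eval_one_derivative_extremaPoly])
  have h1 := abs_eval_basis_extrema_le (j := p + 1) le_rfl ht (d := 2 * (p + 1 : ℕ)) (by positivity)
    (by rw [Chebyshev.node_eq_neg_one (by omega), abs_eval_neg_one_derivative_extremaPoly])
  have hper : cotKernel (p + 1) t (-(p + 1 : ℕ)) = cotKernel (p + 1) t (p + 1 : ℕ) := by
    rw [← cotKernel_periodic (by omega)]
    congr 1
    ring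
  have hhalf : ((p + 1 : ℕ) : ℝ) / (2 * (p + 1 : ℕ)) = 1 / 2 := by field_simp
  rw [hhalf] at h0 h1
  rw [hper] at h1
  have h2 : ∀ r ∈ range p,
      |(Lagrange.basis (extrema (p + 1)) id (Chebyshev.node (p + 1) (r + 1))).eval (Real.cos t)| ≤
        cotKernel (p + 1) t (r + 1 : ℕ) + cotKernel (p + 1) t (-(r + 1 : ℕ)) := by
    intro r hr
    have hr' := mem_range.1 hr
    have := abs_eval_basis_extrema_le (j := r + 1) (by omega) ht hp
      (abs_eval_node_derivative_extremaPoly (by omega) (by omega))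
    rwa [div_self hp.ne', one_mul] at this
  nth_rewrite 1 [extrema]
  rw [sum_image (injOn_node _), sum_range_succ, sum_range_succ', windowSum, sum_range_succ',
    sum_range_succ]
  have h3 := sum_le_sum h2
  rw [sum_add_distrib] at h3
  simp only [Nat.cast_zero, neg_zero, sub_zero, zero_sub, zero_add] at h0 ⊢
  have e1 : ∀ r : ℕ, (1 + r : ℤ) = (r + 1 : ℕ) := fun r => by push_cast; ring
  simp only [e1]
  linarith

/-! ### Kernel estimates and the logarithmic bound -/

theorem abs_cot_half_le {t : ℝ} (h0 : 0 < t) (h1 : t ≤ Real.pi) : |Real.cot (t / 2)| ≤ 2 / t := by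
  rcases h1.eq_or_lt with rfl | h1
  · rw [Real.cot_eq_cos_div_sin, Real.cos_pi_div_two]
    simp
    positivity
  · have h := Real.lt_tan (x := t / 2) (by linarith) (by linarith)
    rw [Real.cot_eq_cos_div_sin, ← inv_div, ← Real.tan_eq_sin_div_cos, abs_inv,
      abs_of_pos (by linarith), ← inv_div t 2]
    exact inv_anti₀ (by linarith) h.le

theorem cotKernel_le_inv {n : ℕ} (hn : n ≠ 0) {t : ℝ} {j : ℤ}
    (h0 : 0 < |t - j * Real.pi / n|) (h1 : |t - j * Real.pi / n| ≤ Real.pi) :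
    cotKernel n t j ≤ 1 / (n * |t - j * Real.pi / n|) ∧ cotKernel n t j ≤ 1 := by
  set s := t - j * Real.pi / n with hs
  have hn' : (0 : ℝ) < n := by positivity
  have hcot : |Real.cot (s / 2)| ≤ 2 / |s| := by
    have h := abs_cot_half_le h0 h1
    rcases abs_cases s with ⟨h2, -⟩ | ⟨h2, -⟩
    · rwa [h2] at h ⊢
    · rw [h2] at h ⊢
      rwa [neg_div, Real.cot_eq_cos_div_sin, Real.cos_neg, Real.sin_neg, div_neg, abs_neg,
        ← Real.cot_eq_cos_div_sin] at h
  have hsin : |Real.sin (n * t)| ≤ n * |s| := by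
    have e : (n * s : ℝ) = n * t - j * Real.pi := by
      rw [hs]
      field_simp
    have e2 : |Real.sin (n * t)| = |Real.sin (n * s)| := by
      rw [e, Real.sin_sub_int_mul_pi, abs_mul, abs_zpow]
      simp
    rw [e2]
    refine Real.abs_sin_le_abs.trans_eq ?_
    rw [abs_mul, abs_of_pos hn']
  -- `B = 1` gives the decay away from the node; `B = n * |s|` cancels the singularity of the
  -- cotangent.
  have hbound : ∀ B : ℝ, 0 ≤ B → |Real.sin (n * t)| ≤ B → cotKernel n t j ≤ B / (n * |s|) := by
    intro B hB0 hB
    calc cotKernel n t j ≤ B * (2 / |s|) / (2 * n) := by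
          rw [cotKernel]
          gcongr
      _ = B / (n * |s|) := by field_simp
  refine ⟨hbound 1 zero_le_one (Real.abs_sin_le_one _), ?_⟩
  have := hbound _ (by positivity) hsin
  rwa [div_self (by positivity)] at this

theorem windowSum_le {f : ℤ → ℝ} {p : ℕ} {c : ℤ}
    (h0 : f c ≤ 1) (h0' : f (c + 1) ≤ 1)
    (h1 : ∀ r : ℕ, r < p → f (c - (r + 1 : ℕ)) ≤ 1 / (Real.pi * (r + 1 : ℕ)))
    (h1' : ∀ r : ℕ, r < p → f (c + 1 + (r + 1 : ℕ)) ≤ 1 / (Real.pi * (r + 1 : ℕ))) :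
    windowSum f (p + 1) c ≤ 2 + 2 / Real.pi * harmonic p := by
  rw [windowSum, sum_range_succ', sum_range_succ']
  have e1 := sum_le_sum fun r hr => h1 r (mem_range.1 hr)
  have e2 := sum_le_sum fun r hr => h1' r (mem_range.1 hr)
  have e3 : ∑ r ∈ range p, 1 / (Real.pi * (r + 1 : ℕ)) = 1 / Real.pi * harmonic p := by
    rw [harmonic, Rat.cast_sum, mul_sum]
    refine sum_congr rfl fun r _ => ?_
    push_cast
    rw [one_div, mul_inv, one_div]
  rw [e3] at e1 e2
  simp only [Nat.cast_zero, sub_zero, add_zero]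
  have e4 : 2 / Real.pi * (harmonic p : ℝ) = 1 / Real.pi * harmonic p + 1 / Real.pi * harmonic p := by
    ring
  linarith

theorem harmonic_cast_nonneg (p : ℕ) : (0 : ℝ) ≤ harmonic p := by
  rw [harmonic]
  push_cast
  positivity

/-- Each dyadic block `2 ^ k, …, 2 ^ (k + 1) - 1` of reciprocals adds at most `1`. -/
theorem harmonic_two_pow_sub_one_le (k : ℕ) : harmonic (2 ^ k - 1) ≤ k := by
  induction k with
  | zero => simp
  | succ k ih =>
    have hk : 0 < 2 ^ k := by positivity
    have e : 2 ^ (k + 1) - 1 = (2 ^ k - 1) + 2 ^ k := by rw [pow_succ]; omega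
    rw [e, harmonic, sum_range_add, ← harmonic]
    have : ∑ i ∈ range (2 ^ k), (((2 ^ k - 1 + i : ℕ) + 1 : ℕ) : ℚ)⁻¹ ≤ 1 := by
      calc _ ≤ ∑ i ∈ range (2 ^ k), ((2 ^ k : ℕ) : ℚ)⁻¹ := by
            refine sum_le_sum fun i _ => inv_anti₀ (by positivity) ?_
            exact_mod_cast (by omega : 2 ^ k ≤ 2 ^ k - 1 + i + 1)
        _ = 1 := by
            rw [sum_const, card_range, nsmul_eq_mul]
            exact mul_inv_cancel₀ (by positivity)
    push_cast at this ⊢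
    linarith

theorem sum_abs_eval_basis_extrema_le_harmonic (p : ℕ) {y : ℝ} (hy : y ∈ Set.Icc (-1) 1) :
    ∑ x ∈ extrema (p + 1), |(Lagrange.basis (extrema (p + 1)) id x).eval y| ≤
      2 + 2 / Real.pi * harmonic p := by
  have hpi := Real.pi_pos
  -- At a node the kernel formula divides by zero, but there the sum is just `1`.
  by_cases hmem : y ∈ extrema (p + 1)
  · rw [sum_eq_single_of_mem y hmem]
    · have := Lagrange.eval_basis_self (v := id) (Set.injOn_id _) hmem
      rw [id] at this
      rw [this, abs_one]
      have := harmonic_cast_nonneg p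
      have : 0 ≤ 2 / Real.pi * harmonic p := by positivity
      linarith
    · intro x _ hxy
      have := Lagrange.eval_basis_of_ne (v := id) hxy hmem
      rw [id] at this
      rw [this, abs_zero]
  obtain ⟨t, ht0, ht1, rfl⟩ : ∃ t, 0 ≤ t ∧ t ≤ Real.pi ∧ Real.cos t = y :=
    ⟨Real.arccos y, Real.arccos_nonneg y, Real.arccos_le_pi y, Real.cos_arccos hy.1 hy.2⟩
  refine (sum_abs_eval_basis_extrema_le_windowSum p hmem).trans ?_
  set n := p + 1 with hn
  have hn' : (0 : ℝ) < n := by positivity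
  -- The angle `t` lies strictly between the grid angles with indices `q` and `q + 1`; the window is
  -- recentred there.
  set q := ⌊n * t / Real.pi⌋₊ with hq
  have hq0 : (q : ℝ) ≤ n * t / Real.pi := Nat.floor_le (by positivity)
  have hq1 : n * t / Real.pi < q + 1 := Nat.lt_floor_add_one _
  have hqn : n * t / Real.pi < n := by
    rw [div_lt_iff₀ hpi]
    refine mul_lt_mul_of_pos_left (ht1.lt_of_ne ?_) hn'
    rintro rfl
    apply hmem
    rw [Real.cos_pi, ← Chebyshev.node_eq_neg_one (n := n) (by omega)]
    exact mem_image_of_mem _ (mem_range.2 (by omega))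
  have hq0' : (q : ℝ) < n * t / Real.pi := by
    refine hq0.lt_of_ne fun h => hmem ?_
    have hlt : q < n := by exact_mod_cast hq0.trans_lt hqn
    have : t = q * Real.pi / n := by
      rw [h]
      field_simp
    rw [this]
    exact mem_image_of_mem (Chebyshev.node n) (mem_range.2 (by omega))
  obtain ⟨u, hu⟩ : ∃ u, u = n * t / Real.pi - q := ⟨_, rfl⟩
  have ht : ∀ s : ℝ, t - s * Real.pi / n = Real.pi / n * (q + u - s) := by
    intro s
    rw [hu]
    field_simp
    ring
  have hu0 : 0 < u := by linarith
  have hu1 : u < 1 := by linarith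
  have hle : ∀ r : ℕ, r ≤ p → (r : ℝ) + 1 ≤ n := fun r hr => by
    exact_mod_cast (by omega : r + 1 ≤ n)
  -- `v` is the distance from `t` in units of `π / n`; `v ≤ r + 1 ≤ n` keeps the angle within `π`,
  -- as the cotangent bound needs.
  have hmain : ∀ (j : ℤ) (v : ℝ) (r : ℕ), r ≤ p → 0 < v → r ≤ v → v ≤ r + 1 →
      |(q + u - j : ℝ)| = v →
      cotKernel n t j ≤ 1 ∧ (0 < r → cotKernel n t j ≤ 1 / (Real.pi * r)) := by
    intro j v r hr hv0 hv1 hv2 hv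
    have habs : |t - j * Real.pi / n| = Real.pi / n * v := by
      rw [ht, abs_mul, hv, abs_of_pos (by positivity)]
    have h := cotKernel_le_inv (n := n) (by omega) (t := t) (j := j)
      (by rw [habs]; positivity)
      (by
        rw [habs, div_mul_eq_mul_div, div_le_iff₀ hn']
        exact mul_le_mul_of_nonneg_left (hv2.trans (hle r hr)) hpi.le)
    refine ⟨h.2, fun hr0 => h.1.trans ?_⟩
    rw [habs, show (n : ℝ) * (Real.pi / n * v) = Real.pi * v by field_simp]
    gcongr
  have hleft : ∀ r : ℕ, |(q + u - ((q : ℤ) - r : ℤ) : ℝ)| = r + u := fun r => by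
    push_cast
    rw [show (q + u - (q - r) : ℝ) = r + u by ring]
    exact abs_of_nonneg (by positivity)
  have hright : ∀ r : ℕ, |(q + u - ((q : ℤ) + 1 + r : ℤ) : ℝ)| = r + (1 - u) := fun r => by
    push_cast
    rw [show (q + u - (q + 1 + r) : ℝ) = -(r + (1 - u)) by ring, abs_neg]
    exact abs_of_nonneg (by linarith [(Nat.cast_nonneg r : (0 : ℝ) ≤ r)])
  have hL : ∀ r : ℕ, r ≤ p → _ := fun r hr =>
    hmain (q - r) (r + u) r hr (by positivity) (by linarith) (by linarith) (hleft r)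
  have hR : ∀ r : ℕ, r ≤ p → _ := fun r hr =>
    hmain (q + 1 + r) (r + (1 - u)) r hr
      (by linarith [(Nat.cast_nonneg r : (0 : ℝ) ≤ r)]) (by linarith) (by linarith) (hright r)
  rw [← windowSum_natCast (fun j => cotKernel_periodic (by omega) t j) q]
  refine windowSum_le ?_ ?_ (fun r hr => ?_) (fun r hr => ?_)
  · simpa using (hL 0 (by omega)).1
  · simpa using (hR 0 (by omega)).1
  · exact (hL (r + 1) hr).2 (by omega)
  · exact (hR (r + 1) hr).2 (by omega)

/-! ### Clenshaw-Curtis levels -/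

/-- The Lebesgue function of one-dimensional interpolation on level `l`. -/
noncomputable def lebesgueFunOne (l : ℕ) (y : ℝ) : ℝ := ∑ x ∈ nodes l, |psi l x y|

theorem lebesgueFunOne_nonneg (l : ℕ) (y : ℝ) : 0 ≤ lebesgueFunOne l y :=
  sum_nonneg fun _ _ => abs_nonneg _

theorem nodes_eq_extrema (k : ℕ) : nodes (k + 2) = extrema (2 ^ (k + 1)) := by
  have hm : ((m (k + 2) : ℕ) : ℝ) - 1 = (2 ^ (k + 1) : ℕ) := by simp [m]
  have hpos : (0 : ℝ) < (2 ^ (k + 1) : ℕ) := by positivity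
  -- The minus sign in `nodes` reverses the order of the extrema.
  have href : ∀ i j : ℕ, i + j = 2 ^ (k + 1) →
      -Real.cos (Real.pi * i / (2 ^ (k + 1) : ℕ)) = Chebyshev.node (2 ^ (k + 1)) j := by
    intro i j hij
    rw [node_eq_cos, ← Real.cos_pi_sub]
    congr 1
    have : (i : ℝ) + j = (2 ^ (k + 1) : ℕ) := by exact_mod_cast hij
    rw [sub_eq_iff_eq_add, ← add_div, eq_div_iff hpos.ne', ← this]
    ring
  ext x
  simp only [nodes, extrema, mem_image, mem_range, hm]
  constructor
  · rintro ⟨i, hi, rfl⟩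
    simp only [m] at hi
    exact ⟨2 ^ (k + 1) - i, by omega, (href _ _ (by omega)).symm⟩
  · rintro ⟨j, hj, rfl⟩
    exact ⟨2 ^ (k + 1) - j, by simp only [m]; omega, href _ _ (by omega)⟩

theorem lebesgueFunOne_zero (y : ℝ) : lebesgueFunOne 0 y = 0 := by
  simp [lebesgueFunOne, nodes]

theorem lebesgueFunOne_one (y : ℝ) : lebesgueFunOne 1 y = 1 := by
  simp [lebesgueFunOne, nodes, psi]

/-- The Lebesgue constants of the Clenshaw-Curtis abscissas grow at most linearly in the level. -/
theorem lebesgueFunOne_le (k : ℕ) {y : ℝ} (hy : y ∈ Set.Icc (-1) 1) :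
    lebesgueFunOne (k + 2) y ≤ 2 + 2 / 3 * (k + 1) := by
  obtain ⟨p, hp⟩ : ∃ p, 2 ^ (k + 1) = p + 1 :=
    ⟨2 ^ (k + 1) - 1, by have : 0 < 2 ^ (k + 1) := by positivity
                         omega⟩
  have hh := harmonic_two_pow_sub_one_le (k + 1)
  rw [hp, Nat.add_sub_cancel] at hh
  have hh' : (harmonic p : ℝ) ≤ k + 1 := by exact_mod_cast hh
  have h := sum_abs_eval_basis_extrema_le_harmonic p hy
  simp only [lebesgueFunOne, psi, nodes_eq_extrema, hp]
  refine h.trans ?_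
  have := Real.pi_gt_three
  have := harmonic_cast_nonneg p
  gcongr

theorem sum_lebesgueFunOne_le {L : ℕ} (hL : 1 ≤ L) {y : ℝ} (hy : y ∈ Set.Icc (-1) 1) :
    ∑ l ∈ Icc 1 (L + 1), (lebesgueFunOne l y + lebesgueFunOne (l - 1) y) ≤
      ((L : ℝ) + 1) * (L + 2) := by
  -- Every level but the top one occurs twice: the quadratic is `2 + 2 * ∑ (2 + 2 / 3 * (l - 1))`
  -- over `2 ≤ l ≤ L`.
  have key : ∑ l ∈ Icc 1 (L + 1), (lebesgueFunOne l y + lebesgueFunOne (l - 1) y) ≤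
      2 / 3 * (L : ℝ) ^ 2 + 10 / 3 * L - 2 + lebesgueFunOne (L + 1) y := by
    induction L, hL using Nat.le_induction with
    | base =>
      rw [sum_Icc_succ_top (by omega)]
      norm_num [lebesgueFunOne_zero, lebesgueFunOne_one]
      linarith
    | succ L hL ih =>
      rw [sum_Icc_succ_top (by omega), Nat.add_sub_cancel]
      obtain ⟨k, rfl⟩ : ∃ k, L = k + 1 := ⟨L - 1, by omega⟩
      have := lebesgueFunOne_le k hy
      push_cast at ih ⊢
      nlinarith
  obtain ⟨k, rfl⟩ : ∃ k, L = k + 1 := ⟨L - 1, by omega⟩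
  have := lebesgueFunOne_le k hy
  push_cast at key ⊢
  nlinarith [sq_nonneg ((k : ℝ) - 1 / 2)]

/-! ### Reduction to one dimension -/

theorem lebesgueFun_le_prod {N L : ℕ} (hN : 1 ≤ N) (y : Fin N → ℝ) :
    lebesgueFun N L y ≤
      ∏ n, ∑ l ∈ Icc 1 (L + 1), (lebesgueFunOne l (y n) + lebesgueFunOne (l - 1) (y n)) := by
  have hgrid : ∀ l : Fin N → ℕ, ∑ x ∈ tensorGrid l, |∏ n, psi (l n) (x n) (y n)| =
      ∏ n, lebesgueFunOne (l n) (y n) := by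
    intro l
    simp only [lebesgueFunOne, abs_prod, tensorGrid]
    rw [prod_univ_sum]
  have hbin : ∀ l : Fin N → ℕ, ∑ i ∈ binaryIndices N, ∏ n, lebesgueFunOne (l n - i n) (y n) =
      ∏ n, (lebesgueFunOne (l n) (y n) + lebesgueFunOne (l n - 1) (y n)) := by
    intro l
    rw [binaryIndices, ← prod_univ_sum (fun _ => {0, 1})
      (fun n i => lebesgueFunOne (l n - i) (y n))]
    simp
  calc lebesgueFun N L y
      ≤ ∑ x ∈ sparseGrid N L, ∑ l ∈ multiIndices N L,
          ∑ i ∈ (binaryIndices N).filter fun i => x ∈ tensorGrid fun n => l n - i n,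
            |∏ n, psi (l n - i n) (x n) (y n)| := by
        refine sum_le_sum fun x _ => ?_
        refine (abs_sum_le_sum_abs _ _).trans (sum_le_sum fun l _ => ?_)
        refine (abs_sum_le_sum_abs _ _).trans (sum_le_sum fun i _ => ?_)
        simp [abs_mul]
    _ = ∑ l ∈ multiIndices N L, ∑ i ∈ binaryIndices N, ∏ n, lebesgueFunOne (l n - i n) (y n) := by
        rw [sum_comm]
        refine sum_congr rfl fun l hl => ?_
        simp only [sum_filter]
        rw [sum_comm]
        refine sum_congr rfl fun i _ => ?_
        -- Each tensor grid lies in the sparse grid, so its sum is complete and factorizes.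
        rw [← sum_filter, filter_mem_eq_inter,
          inter_eq_right.2 (tensorGrid_subset_sparseGrid hN hl), hgrid fun n => l n - i n]
    _ ≤ ∑ l ∈ Fintype.piFinset fun _ : Fin N => Icc 1 (L + 1),
          ∏ n, (lebesgueFunOne (l n) (y n) + lebesgueFunOne (l n - 1) (y n)) := by
        simp only [hbin]
        exact sum_le_sum_of_subset_of_nonneg (filter_subset _ _) fun l _ _ =>
          prod_nonneg fun n _ => add_nonneg (lebesgueFunOne_nonneg _ _) (lebesgueFunOne_nonneg _ _)
    _ = _ := by rw [prod_univ_sum]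

theorem lebesgueFun_le {N L : ℕ} (hN : 1 ≤ N) (hL : 1 ≤ L) {y : Fin N → ℝ} (hy : y ∈ Gam N) :
    lebesgueFun N L y ≤ (((L : ℝ) + 1) * ((L : ℝ) + 2)) ^ N := by
  have h : ∀ n ∈ (univ : Finset (Fin N)),
      ∑ l ∈ Icc 1 (L + 1), (lebesgueFunOne l (y n) + lebesgueFunOne (l - 1) (y n)) ≤
        ((L : ℝ) + 1) * ((L : ℝ) + 2) :=
    fun n _ => sum_lebesgueFunOne_le hL (hy n (Set.mem_univ n))
  have h0 : ∀ n ∈ (univ : Finset (Fin N)),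
      0 ≤ ∑ l ∈ Icc 1 (L + 1), (lebesgueFunOne l (y n) + lebesgueFunOne (l - 1) (y n)) :=
    fun n _ => sum_nonneg fun l _ =>
      add_nonneg (lebesgueFunOne_nonneg _ _) (lebesgueFunOne_nonneg _ _)
  have hprod := prod_le_prod h0 h
  rw [prod_const, card_univ, Fintype.card_fin] at hprod
  exact (lebesgueFun_le_prod hN y).trans hprod

end SparseGrid

theorem lemma4p3 (N L : ℕ) (hN : 1 ≤ N) (hL : 1 ≤ L) :
    SparseGrid.lebesgueConst N L ≤ (((L : ℝ) + 1) * ((L : ℝ) + 2)) ^ N := by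
  obtain ⟨y, hy, h⟩ := (SparseGrid.isGreatest_lebesgueConst N L).1
  rw [← h]
  exact SparseGrid.lebesgueFun_le hN hL hy
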